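/- Equip the category $\mathrm{SmCat}$ of small categories with the Joyal–Tierney model structure: weak equivalences are the equivalences of categories, cofibrations are the functors injective on objects, fibrations are the isofibrations. Write $1$ for the terminal object. Call $W$ a homotopy pushout of $Y\leftarrow X\to Z$ if $W$ is the pushout of a span of cofibrations $\tilde Y\leftarrow\tilde X\to\tilde Z$ with $\tilde X$ cofibrant, mapping to the given span by acyclic fibrations $\tilde X\to X$, $\tilde Y\to Y$, $\tilde Z\to Z$. For $X$ cofibrant, call $W$ a one-sided homotopy pushout of $f:X\to Z$ along $g:X\to Y$ if $g$ factors as a cofibration $X\to\tilde Y$ followed by an acyclic fibration $\tilde Y\to Y$ and $W$ is the pushout of $\tilde Y\leftarrow X\xrightarrow{f} Z$. The $0$-sphere is $1\amalg 1$; for $n\ge 1$ an $n$-sphere is a homotopy pushout of $1\leftarrow Y\to 1$ with $Y$ an $(n-1)$-sphere. A $0$-dimensional CW-complex is a cofibrant object that is a coproduct of copies of $1$; for $n\ge1$ an $n$-dimensional CW-complex is a one-sided homotopy pushout $X$ of a map $\coprod_{i\in I}S_i\to Y$ along $\coprod_{i\in I}S_i\to\coprod_{i\in I}1$, where $I$ is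 a set, each $S_i$ is an $(n-1)$-sphere and $Y$ is an $(n-1)$-dimensional CW-complex; the map $Y\to X$ is then called an $(n-1)$-skeleton inclusion. A finite-dimensional CW-complex is an $n$-dimensional one for some $n\ge 0$. A CW-complex is a cofibrant object weakly equivalent to the colimit of a sequence $X_0\to X_1\to X_2\to\cdots$ in which each $X_n$ is an $n$-dimensional CW-complex and each $X_n\to X_{n+1}$ is an $n$-skeleton inclusion. Two objects are weakly equivalent if they are joined by a zigzag of weak equivalences. Theorem. 1. A small category is weakly equivalent to a CW-complex if and only if it is a groupoid; likewise, it is weakly equivalent to a finite-dimensional CW-complex if and only if it is a groupoid. 2. Every CW-complex, and every finite-dimensional CW-complex, in $\mathrm{SmCat}$ is weakly equivalent to a $2$-dimensional CW-complex. 3. For every $n\ge 2$, $n$-spheres exist in $\mathrm{SmCat}$, and every $n$-sphere is contractible, i.e. weakly equivalent to $1$. -/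

import Mathlib

open CategoryTheory CategoryTheory.Limits HomotopicalAlgebra

universe v u

namespace FormalCW

section General

variable {C : Type u} [Category.{v} C]

/-- Two objects are weakly equivalent if they are joined by a finite zigzag of weak
equivalences. -/
def WeaklyEquivalent [CategoryWithWeakEquivalences C] (X Y : C) : Prop :=
  Relation.EqvGen (fun A B : C => ∃ f : A ⟶ B, WeakEquivalence f) X Y

variable [CategoryWithCofibrations C] [CategoryWithFibrations C]
  [CategoryWithWeakEquivalences C] [HasTerminal C] [HasColimits C]

/-- `W` is a homotopy pushout of the span `Y ⟵g⟵ X ⟶f⟶ Z`: it is the strict pushout of a span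
`Y' ⟵ X' ⟶ Z'` of cofibrations with `X'` cofibrant, which maps to the given span by acyclic
fibrations. -/
def IsHomotopyPushout {X Y Z : C} (f : X ⟶ Z) (g : X ⟶ Y) (W : C) : Prop :=
  ∃ (X' Y' Z' : C) (f' : X' ⟶ Z') (g' : X' ⟶ Y') (pX : X' ⟶ X) (pY : Y' ⟶ Y) (pZ : Z' ⟶ Z)
    (k : Z' ⟶ W) (l : Y' ⟶ W),
    IsCofibrant X' ∧ Cofibration f' ∧ Cofibration g' ∧
    (Fibration pX ∧ WeakEquivalence pX) ∧
    (Fibration pY ∧ WeakEquivalence pY) ∧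
    (Fibration pZ ∧ WeakEquivalence pZ) ∧
    f' ≫ pZ = pX ≫ f ∧ g' ≫ pY = pX ≫ g ∧
    IsPushout f' g' k l

/-- `W` is a one-sided homotopy pushout of `f : X ⟶ Z` along `g : X ⟶ Y`, with canonical map
`j : Z ⟶ W`: the object `X` is cofibrant, `g` factors as a cofibration `X ⟶ Y'` followed by an
acyclic fibration `Y' ⟶ Y`, and `W` is the strict pushout of `Y' ⟵ X ⟶ Z`. -/
def IsOneSidedHomotopyPushout {X Y Z W : C} (f : X ⟶ Z) (g : X ⟶ Y) (j : Z ⟶ W) : Prop :=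
  IsCofibrant X ∧
  ∃ (Y' : C) (i : X ⟶ Y') (p : Y' ⟶ Y) (l : Y' ⟶ W),
    Cofibration i ∧ (Fibration p ∧ WeakEquivalence p) ∧ i ≫ p = g ∧ IsPushout f i j l

/-- `X` is an `n`-sphere: the `0`-sphere is the coproduct of two copies of the terminal object,
and an `(n + 1)`-sphere is a homotopy pushout of `1 ⟵ Y ⟶ 1` with `Y` an `n`-sphere. -/
def IsSphere : ℕ → C → Prop
  | 0, X => Nonempty (X ≅ (⊤_ C) ⨿ (⊤_ C))
  | n + 1, X => ∃ Y : C, IsSphere n Y ∧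
      IsHomotopyPushout (terminal.from Y) (terminal.from Y) X

/-- The map `j : Y ⟶ X` attaches `(n + 1)`-cells to `Y`: it is the canonical map into a one-sided
homotopy pushout of a map `∐ S i ⟶ Y` out of a coproduct of `n`-spheres along
`∐ S i ⟶ ∐ 1`. -/
def AttachesCells (n : ℕ) {Y X : C} (j : Y ⟶ X) : Prop :=
  ∃ (I : Type v) (S : I → C) (f : (∐ S) ⟶ Y), (∀ i, IsSphere n (S i)) ∧
    IsOneSidedHomotopyPushout f
      (Limits.Sigma.map (g := fun _ : I => ⊤_ C) fun i => terminal.from (S i)) j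

/-- `X` is an `n`-dimensional CW-complex. -/
def IsCWComplexOfDim : ℕ → C → Prop
  | 0, X => IsCofibrant X ∧ ∃ I : Type v, Nonempty (X ≅ ∐ fun _ : I => ⊤_ C)
  | n + 1, X => ∃ (Y : C) (j : Y ⟶ X), IsCWComplexOfDim n Y ∧ AttachesCells n j

/-- `j : Y ⟶ X` is an `n`-skeleton inclusion. -/
def IsSkeletonInclusion (n : ℕ) {Y X : C} (j : Y ⟶ X) : Prop :=
  IsCWComplexOfDim n Y ∧ AttachesCells n j

/-- `X` is a finite-dimensional CW-complex. -/
def IsFiniteDimCWComplex (X : C) : Prop := ∃ n, IsCWComplexOfDim n X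

/-- `X` is a CW-complex, of possibly infinite dimension: `X` is cofibrant and weakly equivalent to
the colimit of a sequence `X₀ ⟶ X₁ ⟶ X₂ ⟶ ⋯` in which `Xₙ` is an `n`-dimensional CW-complex and
`Xₙ ⟶ Xₙ₊₁` is an `n`-skeleton inclusion. -/
def IsCWComplex (X : C) : Prop :=
  IsCofibrant X ∧ ∃ F : ℕ ⥤ C,
    (∀ n, IsCWComplexOfDim n (F.obj n)) ∧
    (∀ n, IsSkeletonInclusion n (F.map (homOfLE (Nat.le_succ n)))) ∧
    WeaklyEquivalent X (colimit F)

end General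

/-- A functor is an isofibration if every isomorphism `F X ≅ Y` lifts to an isomorphism
`X ≅ Y'`. -/
def IsIsofibration {A B : Type*} [Category A] [Category B] (F : A ⥤ B) : Prop :=
  ∀ (X : A) (Y : B) (e : F.obj X ≅ Y), ∃ (Y' : A) (e' : X ≅ Y') (h : F.obj Y' = Y),
    F.map e'.hom ≫ eqToHom h = e.hom

/-! The three classes of maps of the Joyal–Tierney model structure on small categories. -/

/-- The cofibrations are the functors that are injective on objects. -/
instance joyalTierneyCofibrations : CategoryWithCofibrations Cat.{u, u} where
  cofibrations _ _ F := Function.Injective F.toFunctor.obj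

/-- The fibrations are the isofibrations. -/
instance joyalTierneyFibrations : CategoryWithFibrations Cat.{u, u} where
  fibrations _ _ F := IsIsofibration F.toFunctor

/-- The weak equivalences are the equivalences of categories. -/
instance joyalTierneyWeakEquivalences : CategoryWithWeakEquivalences Cat.{u, u} where
  weakEquivalences _ _ F := F.toFunctor.IsEquivalence

end FormalCW

/-!
Groupoids are closed under colimits and equivalences of categories, so all spheres and all
CW-complexes are groupoids. Conversely, a groupoid `X` is a `2`-dimensional CW-complex: take its
objects as `0`-cells and its isomorphisms as `1`-cells. The evaluation functor from this
`1`-skeleton to `X` is full and bijective on objects, so it exhibits `X` as the quotient which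
identifies all pairs of parallel isomorphisms with the same image, and identifying such a pair is
attaching a `2`-cell.

By the van Kampen theorem, a pushout of contractible groupoids along a connected groupoid is
contractible. Since spheres of positive dimension are connected, all spheres of dimension at least
`2` are contractible.
-/

namespace FormalCW

section Objects

/-- The functor to a codiscrete category given by a map on objects. -/
def toCodiscrete {C : Type*} [Category* C] {A : Type u} (f : C → A) :
    C ⥤ ULiftHom.{v} (Codiscrete A) :=
  Codiscrete.functor f ⋙ ULiftHom.up

/-- The codiscrete category on a type, which has exactly one morphism between any two objects.
Mathlib's `Codiscrete A` has its morphisms in `Type`, whence the lift. -/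
def codiscreteCat : Type u ⥤ Cat.{v, u} where
  obj A := Cat.of (ULiftHom.{v} (Codiscrete A))
  map f := (toCodiscrete fun x : ULiftHom (Codiscrete _) => f (ULiftHom.objDown x).as).toCatHom

/-- The codiscrete category functor is right adjoint to the functor of objects. -/
def objectsAdjCodiscrete : Cat.objects.{v, u} ⊣ codiscreteCat.{v, u} :=
  Adjunction.mkOfHomEquiv
    { homEquiv _ _ := TypeCat.homEquiv.trans
        { toFun f := (toCodiscrete f).toCatHom
          invFun F x := (ULiftHom.objDown.{u, v} (F.toFunctor.obj x)).as
          left_inv _ := rfl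
          right_inv _ := rfl } }

instance : Cat.objects.{v, u}.IsLeftAdjoint := objectsAdjCodiscrete.isLeftAdjoint

lemma isIso_objects_map_iff {A B : Cat.{v, u}} (F : A ⟶ B) :
    IsIso (Cat.objects.map F) ↔ Function.Bijective F.toFunctor.obj :=
  isIso_iff_bijective _

lemma bijective_obj_of_isIso {A B : Cat.{v, u}} (F : A ⟶ B) [IsIso F] :
    Function.Bijective F.toFunctor.obj := by
  rw [← isIso_objects_map_iff]
  infer_instance

lemma bijective_obj_of_comp {A B C : Cat.{v, u}} {F : A ⟶ B} {G : B ⟶ C}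
    (hF : Function.Bijective F.toFunctor.obj)
    (hFG : Function.Bijective (F ≫ G).toFunctor.obj) : Function.Bijective G.toFunctor.obj :=
  (Function.Bijective.of_comp_iff _ hF).1 hFG

variable {A B C D : Cat.{v, u}} {f : A ⟶ B} {g : A ⟶ C} {k : B ⟶ D} {l : C ⟶ D}

lemma bijective_obj_of_isPushout (h : IsPushout f g k l)
    (hg : Function.Bijective g.toFunctor.obj) : Function.Bijective k.toFunctor.obj := by
  rw [← isIso_objects_map_iff] at hg ⊢
  exact (h.map Cat.objects).isIso_inl_of_isIso hg

lemma exists_obj_eq_or_of_isPushout (h : IsPushout f g k l) (d : D) :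
    (∃ b, k.toFunctor.obj b = d) ∨ ∃ c, l.toFunctor.obj c = d :=
  (Limits.Types.eq_or_eq_of_isPushout (h.map Cat.objects) d).imp
    (fun ⟨b, hb⟩ => ⟨b, hb⟩) (fun ⟨c, hc⟩ => ⟨c, hc⟩)

end Objects

section SurjectiveEquivalence

/-- A surjective equivalence is an equivalence of categories which is surjective on objects. These
functors are the acyclic fibrations of the Joyal–Tierney model structure. -/
structure IsSurjectiveEquivalence {A B : Type*} [Category* A] [Category* B] (F : A ⥤ B) :
    Prop where
  full : F.Full
  faithful : F.Faithful
  surjective_obj : Function.Surjective F.obj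

namespace IsSurjectiveEquivalence

lemma isEquivalence {A B : Type*} [Category* A] [Category* B] {F : A ⥤ B}
    (hF : IsSurjectiveEquivalence F) : F.IsEquivalence where
  full := hF.full
  faithful := hF.faithful
  essSurj := ⟨fun b => (hF.surjective_obj b).imp fun _ h => ⟨eqToIso h⟩⟩

lemma isIsofibration {A B : Type*} [Category* A] [Category* B] {F : A ⥤ B}
    (hF : IsSurjectiveEquivalence F) : IsIsofibration F := by
  intro a b e
  obtain ⟨a', rfl⟩ := hF.surjective_obj b
  have := hF.full
  have := hF.faithful
  exact ⟨a', F.preimageIso e, rfl, by simp⟩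

lemma acyclicFibration {A B : Cat.{u, u}} {F : A ⟶ B}
    (hF : IsSurjectiveEquivalence F.toFunctor) : Fibration F ∧ WeakEquivalence F :=
  ⟨(fibration_iff F).2 hF.isIsofibration, (weakEquivalence_iff F).2 hF.isEquivalence⟩

lemma comp {A B C : Type*} [Category* A] [Category* B] [Category* C] {F : A ⥤ B} {G : B ⥤ C}
    (hF : IsSurjectiveEquivalence F) (hG : IsSurjectiveEquivalence G) :
    IsSurjectiveEquivalence (F ⋙ G) :=
  have := hF.full
  have := hF.faithful
  have := hG.full
  have := hG.faithful
  ⟨inferInstance, inferInstance, hG.surjective_obj.comp hF.surjective_obj⟩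

lemma of_isIso {A B : Cat.{v, u}} (F : A ⟶ B) [IsIso F] :
    IsSurjectiveEquivalence F.toFunctor :=
  have : F.toFunctor.IsEquivalence := (Cat.equivOfIso (asIso F)).isEquivalence_functor
  ⟨inferInstance, inferInstance, (bijective_obj_of_isIso F).surjective⟩

end IsSurjectiveEquivalence

lemma weakEquivalence_of_isIso {A B : Cat.{u, u}} (F : A ⟶ B) [IsIso F] : WeakEquivalence F :=
  (IsSurjectiveEquivalence.of_isIso F).acyclicFibration.2

lemma isCofibrant (X : Cat.{u, u}) : IsCofibrant X := by
  have : IsEmpty (⊥_ Cat.{u, u} : Cat.{u, u}) :=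
    ⟨fun x => ((initial.to (Cat.of (Discrete PEmpty.{u + 1}))).toFunctor.obj x).as.elim⟩
  exact (cofibration_iff _).2 (Function.injective_of_subsingleton _)

end SurjectiveEquivalence

section Contractible

/-- A category is contractible if it is equivalent to the terminal category, that is, if it has an
object and exactly one morphism between any two objects. -/
structure IsContractible (A : Type*) [Category* A] : Prop where
  nonempty : Nonempty A
  nonempty_hom (x y : A) : Nonempty (x ⟶ y)
  subsingleton_hom (x y : A) : Subsingleton (x ⟶ y)

namespace IsContractible

variable {A B : Type*} [Category* A] [Category* B]

lemma of_isEquivalence (F : A ⥤ B) [F.IsEquivalence] (hB : IsContractible B) :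
    IsContractible A where
  nonempty := hB.nonempty.map F.inv.obj
  nonempty_hom x y := (hB.nonempty_hom (F.obj x) (F.obj y)).map F.preimage
  subsingleton_hom _ _ := ⟨fun _ _ => F.map_injective ((hB.subsingleton_hom _ _).elim _ _)⟩

lemma isConnected (hA : IsContractible A) : IsConnected A :=
  have := hA.nonempty
  zigzag_isConnected fun x y => .of_hom (hA.nonempty_hom x y).some

lemma isSurjectiveEquivalence (hA : IsContractible A) (hB : IsContractible B) {F : A ⥤ B}
    (hF : Function.Surjective F.obj) : IsSurjectiveEquivalence F where
  full := ⟨fun {x y} _ => ⟨(hA.nonempty_hom x y).some, (hB.subsingleton_hom _ _).elim _ _⟩⟩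
  faithful := ⟨fun {x y} _ _ _ => (hA.subsingleton_hom x y).elim _ _⟩
  surjective_obj := hF

end IsContractible

lemma isContractible_codiscreteCat (A : Type u) [Nonempty A] :
    IsContractible (codiscreteCat.{v}.obj A) where
  nonempty := ‹Nonempty A›.map fun a => ULiftHom.objUp.{u, v} ⟨a⟩
  nonempty_hom _ _ := ⟨⟨⟨⟩⟩⟩
  subsingleton_hom _ _ := inferInstanceAs (Subsingleton (ULift Unit))

lemma isContractible_terminal : IsContractible (⊤_ Cat.{u, u} : Cat.{u, u}) :=
  have : (terminalIsoIsTerminal Cat.isTerminalDiscretePUnit.{u}).hom.toFunctor.IsEquivalence :=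
    (IsSurjectiveEquivalence.of_isIso _).isEquivalence
  .of_isEquivalence (terminalIsoIsTerminal Cat.isTerminalDiscretePUnit.{u}).hom.toFunctor
    { nonempty := ⟨⟨⟨⟩⟩⟩
      nonempty_hom := fun ⟨_⟩ ⟨_⟩ => ⟨𝟙 _⟩
      subsingleton_hom := (Discrete.isDiscrete PUnit).subsingleton }

noncomputable instance : Unique (⊤_ Cat.{u, u} : Cat.{u, u}) :=
  letI : Unique (Cat.of (Discrete PUnit.{u + 1})) := inferInstanceAs (Unique (Discrete PUnit))
  (Equiv.ofBijective _ (bijective_obj_of_isIso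
    (terminalIsoIsTerminal Cat.isTerminalDiscretePUnit.{u}).hom)).unique

instance : IsDiscrete (⊤_ Cat.{u, u} : Cat.{u, u}) where
  subsingleton := isContractible_terminal.subsingleton_hom
  eq_of_hom _ := Subsingleton.elim _ _

lemma IsContractible.isSurjectiveEquivalence_terminal {A : Cat.{u, u}} (hA : IsContractible A)
    (F : A ⟶ ⊤_ Cat.{u, u}) : IsSurjectiveEquivalence F.toFunctor :=
  have := hA.nonempty
  hA.isSurjectiveEquivalence isContractible_terminal (Function.surjective_to_subsingleton _)

lemma isContractible_of_weakEquivalence_terminal {A : Cat.{u, u}} (F : A ⟶ ⊤_ Cat.{u, u})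
    [hF : WeakEquivalence F] : IsContractible A :=
  have : F.toFunctor.IsEquivalence := (weakEquivalence_iff F).1 hF
  .of_isEquivalence F.toFunctor isContractible_terminal

end Contractible

section Groupoid

lemma isGroupoid_of_retract {A G : Type*} [Category* A] [Category* G] [IsGroupoid G]
    (F : A ⥤ G) (H : G ⥤ A) (e : F ⋙ H ≅ 𝟭 A) : IsGroupoid A :=
  ⟨fun f => (NatIso.isIso_map_iff e f).1 (inferInstanceAs (IsIso (H.map (F.map f))))⟩

/-- The factorisation of a functor out of a groupoid through the core of its target. -/
noncomputable def toCore {A B : Cat.{v, u}} [IsGroupoid A] (F : A ⟶ B) :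
    A ⟶ Cat.of (Core B) :=
  letI : Groupoid A := Groupoid.ofIsGroupoid
  (Core.functorToCore F.toFunctor).toCatHom

lemma toCore_comp_inclusion {A B : Cat.{v, u}} [IsGroupoid A] (F : A ⟶ B) :
    toCore F ≫ (Core.inclusion B).toCatHom = F :=
  rfl

lemma comp_toCore {A B C : Cat.{v, u}} [IsGroupoid A] [IsGroupoid B] (F : A ⟶ B) (G : B ⟶ C) :
    F ≫ toCore G = toCore (F ≫ G) :=
  Cat.ext (Functor.hext (fun _ => rfl) fun _ _ _ => heq_of_eq (Core.hom_ext rfl))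

/-- The legs of the colimit factor through its core, so the colimit is a retract of its core. -/
lemma isGroupoid_of_isColimit {J : Type*} [Category* J] {F : J ⥤ Cat.{v, u}} {c : Cocone F}
    (hc : IsColimit c) (hF : ∀ j, IsGroupoid (F.obj j)) : IsGroupoid c.pt := by
  let s : Cocone F :=
    { pt := Cat.of (Core c.pt)
      ι := { app j := toCore (c.ι.app j)
             naturality i j f := by
               rw [comp_toCore, c.w]
               exact (Category.comp_id _).symm } }
  have hs : hc.desc s ≫ (Core.inclusion c.pt).toCatHom = 𝟙 c.pt :=
    hc.hom_ext fun j => (hc.fac_assoc s j _).trans <|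
      (toCore_comp_inclusion (c.ι.app j)).trans (Category.comp_id _).symm
  exact isGroupoid_of_retract (G := Core c.pt) (hc.desc s).toFunctor (Core.inclusion c.pt)
    (eqToIso (congrArg Cat.Hom.toFunctor hs))

lemma isGroupoid_of_isPushout {A B C D : Cat.{v, u}} {f : A ⟶ B} {g : A ⟶ C} {k : B ⟶ D}
    {l : C ⟶ D} (h : IsPushout f g k l) (hA : IsGroupoid A) (hB : IsGroupoid B)
    (hC : IsGroupoid C) : IsGroupoid D :=
  isGroupoid_of_isColimit h.isColimit (by rintro (_ | _ | _) <;> assumption)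

lemma isGroupoid_sigma {I : Type u} {F : I → Cat.{u, u}} (hF : ∀ i, IsGroupoid (F i)) :
    IsGroupoid (∐ F : Cat.{u, u}) :=
  isGroupoid_of_isColimit (coproductIsCoproduct F) fun ⟨i⟩ => hF i

lemma IsContractible.isGroupoid {A : Type*} [Category* A] (hA : IsContractible A) :
    IsGroupoid A :=
  ⟨fun {x y} _ => ⟨(hA.nonempty_hom y x).some, (hA.subsingleton_hom _ _).elim _ _,
    (hA.subsingleton_hom _ _).elim _ _⟩⟩

lemma isGroupoid_iff_of_isEquivalence {A B : Type*} [Category* A] [Category* B] (F : A ⥤ B)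
    [F.IsEquivalence] : IsGroupoid A ↔ IsGroupoid B :=
  ⟨fun _ => isGroupoid_of_reflects_iso F.inv, fun _ => isGroupoid_of_reflects_iso F⟩

lemma WeaklyEquivalent.isGroupoid_iff {A B : Cat.{u, u}} (h : WeaklyEquivalent A B) :
    IsGroupoid A ↔ IsGroupoid B := by
  induction h with
  | rel A B h =>
    obtain ⟨F, hF⟩ := h
    have : F.toFunctor.IsEquivalence := (weakEquivalence_iff F).1 hF
    exact isGroupoid_iff_of_isEquivalence F.toFunctor
  | refl => rfl
  | symm _ _ _ ih => exact ih.symm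
  | trans _ _ _ _ _ ih₁ ih₂ => exact ih₁.trans ih₂

lemma isGroupoid_of_iso {A B : Cat.{u, u}} (e : A ≅ B) (hB : IsGroupoid B) : IsGroupoid A :=
  (WeaklyEquivalent.isGroupoid_iff (.rel _ _ ⟨e.hom, weakEquivalence_of_isIso e.hom⟩)).2 hB

end Groupoid

section Sphere

/-- Both leaves of the span are equivalent to the terminal category, so that an `(n + 1)`-sphere is
a strict pushout of two contractible categories. -/
lemma IsSphere.exists_isPushout {n : ℕ} {S : Cat.{u, u}} (hS : IsSphere (n + 1) S) :
    ∃ (Y A B C : Cat.{u, u}) (p : A ⟶ Y) (f : A ⟶ B) (g : A ⟶ C) (k : B ⟶ S) (l : C ⟶ S),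
      IsSphere n Y ∧ p.toFunctor.IsEquivalence ∧ IsContractible B ∧ IsContractible C ∧
        IsPushout f g k l := by
  obtain ⟨Y, hY, A, C, B, f, g, pA, pC, pB, k, l, -, -, -, hA, hC, hB, -, -, h⟩ := hS
  have := hC.2
  have := hB.2
  exact ⟨Y, A, B, C, pA, f, g, k, l, hY, (weakEquivalence_iff pA).1 hA.2,
    isContractible_of_weakEquivalence_terminal pB,
    isContractible_of_weakEquivalence_terminal pC, h⟩

lemma IsSphere.isGroupoid {n : ℕ} {S : Cat.{u, u}} (hS : IsSphere n S) : IsGroupoid S := by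
  induction n generalizing S with
  | zero =>
    obtain ⟨e⟩ := hS
    exact isGroupoid_of_iso e (isGroupoid_of_isColimit (colimit.isColimit (pair _ _))
      (by rintro ⟨_ | _⟩ <;> exact isContractible_terminal.isGroupoid))
  | succ n ih =>
    obtain ⟨Y, A, B, C, p, f, g, k, l, hY, _, hB, hC, h⟩ := hS.exists_isPushout
    exact isGroupoid_of_isPushout h
      ((isGroupoid_iff_of_isEquivalence p.toFunctor).2 (ih hY)) hB.isGroupoid hC.isGroupoid

lemma IsSphere.succ_of_isPushout {n : ℕ} {A B C S : Cat.{u, u}} (hA : IsSphere n A)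
    (hB : IsContractible B) (hC : IsContractible C) {f : A ⟶ B} {g : A ⟶ C} {k : B ⟶ S}
    {l : C ⟶ S} (hf : Function.Injective f.toFunctor.obj)
    (hg : Function.Injective g.toFunctor.obj) (h : IsPushout f g k l) : IsSphere (n + 1) S :=
  ⟨A, hA, A, C, B, f, g, 𝟙 A, terminal.from C, terminal.from B, k, l, isCofibrant A,
    (cofibration_iff f).2 hf, (cofibration_iff g).2 hg,
    (IsSurjectiveEquivalence.of_isIso (𝟙 A)).acyclicFibration,
    (hC.isSurjectiveEquivalence_terminal _).acyclicFibration,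
    (hB.isSurjectiveEquivalence_terminal _).acyclicFibration,
    Subsingleton.elim _ _, Subsingleton.elim _ _, h⟩

lemma exists_isSphere (n : ℕ) : ∃ S : Cat.{u, u}, IsSphere n S := by
  induction n with
  | zero => exact ⟨_, ⟨Iso.refl _⟩⟩
  | succ n ih =>
    obtain ⟨Y, hY⟩ := ih
    let cone : Y ⟶ codiscreteCat.obj (Option Y) := (toCodiscrete some).toCatHom
    have hcone : Function.Injective cone.toFunctor.obj := fun x y h =>
      Option.some_injective _ (congrArg Codiscrete.as h)
    have hC := isContractible_codiscreteCat (Option Y)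
    exact ⟨_, hY.succ_of_isPushout hC hC hcone hcone (IsPushout.of_hasPushout cone cone)⟩

lemma IsSphere.nonempty {n : ℕ} {S : Cat.{u, u}} (hS : IsSphere n S) : Nonempty S := by
  cases n with
  | zero =>
    obtain ⟨e⟩ := hS
    exact ⟨((coprod.inl : ⊤_ Cat.{u, u} ⟶ _) ≫ e.inv).toFunctor.obj default⟩
  | succ n =>
    obtain ⟨Y, A, B, C, p, f, g, k, l, -, -, hB, -, -⟩ := hS.exists_isPushout
    exact hB.nonempty.map k.toFunctor.obj

lemma isConnected_of_isPushout {A B C D : Cat.{v, u}} {f : A ⟶ B} {g : A ⟶ C} {k : B ⟶ D}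
    {l : C ⟶ D} (h : IsPushout f g k l) [Nonempty A] [IsConnected B] [IsConnected C] :
    IsConnected D := by
  obtain ⟨a⟩ := ‹Nonempty A›
  let d := k.toFunctor.obj (f.toFunctor.obj a)
  have hd : d = l.toFunctor.obj (g.toFunctor.obj a) :=
    Functor.congr_obj (congrArg Cat.Hom.toFunctor h.w) a
  have : Nonempty D := ⟨d⟩
  refine .of_any_functor_const_on_obj fun F x => ?_
  suffices hF : ∀ x, F.obj x = F.obj d from fun y => (hF x).trans (hF y).symm
  intro x
  rcases exists_obj_eq_or_of_isPushout h x with ⟨b, rfl⟩ | ⟨c, rfl⟩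
  · exact any_functor_const_on_obj (k.toFunctor ⋙ F) b _
  · rw [hd]
    exact any_functor_const_on_obj (l.toFunctor ⋙ F) c _

lemma IsSphere.isConnected {n : ℕ} {S : Cat.{u, u}} (hS : IsSphere (n + 1) S) :
    IsConnected S := by
  obtain ⟨Y, A, B, C, p, f, g, k, l, hY, _, hB, hC, h⟩ := hS.exists_isPushout
  have := hB.isConnected
  have := hC.isConnected
  have := hY.nonempty
  have : Nonempty A := ⟨p.toFunctor.objPreimage hY.nonempty.some⟩
  exact isConnected_of_isPushout h

end Sphere

section VanKampen

/-- The functor to the arrow category which corresponds to a natural transformation. -/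
def arrowFunctor {C E : Type*} [Category* C] [Category* E] {P Q : C ⥤ E} (α : P ⟶ Q) :
    C ⥤ Arrow E where
  obj c := Arrow.mk (α.app c)
  map m := Arrow.homMk (P.map m) (Q.map m)

lemma functor_arrow_ext {C E : Type*} [Category* C] [Category* E] {F G : C ⥤ Arrow E}
    (hobj : ∀ c, F.obj c = G.obj c) (hleft : F ⋙ Arrow.leftFunc = G ⋙ Arrow.leftFunc)
    (hright : F ⋙ Arrow.rightFunc = G ⋙ Arrow.rightFunc) : F = G := by
  refine CategoryTheory.Functor.ext hobj fun c c' m => Arrow.hom_ext _ _ ?_ ?_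
  · rw [Arrow.comp_left, Arrow.comp_left, Arrow.eqToHom_left, Arrow.eqToHom_left]
    exact Functor.congr_hom hleft m
  · rw [Arrow.comp_right, Arrow.comp_right, Arrow.eqToHom_right, Arrow.eqToHom_right]
    exact Functor.congr_hom hright m

/-- A natural transformation between functors to `E` is a functor to the arrow category of `E`, so
the universal property of the pushout applies to it. -/
lemma nonempty_natTrans_of_isPushout {A B C D E : Cat.{u, u}} {f : A ⟶ B} {g : A ⟶ C}
    {k : B ⟶ D} {l : C ⟶ D} (h : IsPushout f g k l) {P Q : D ⥤ E}
    (α : k.toFunctor ⋙ P ⟶ k.toFunctor ⋙ Q) (β : l.toFunctor ⋙ P ⟶ l.toFunctor ⋙ Q)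
    (hαβ : ∀ a, Arrow.mk (α.app (f.toFunctor.obj a)) = Arrow.mk (β.app (g.toFunctor.obj a))) :
    Nonempty (P ⟶ Q) := by
  have hw : f.toFunctor ⋙ k.toFunctor = g.toFunctor ⋙ l.toFunctor :=
    congrArg Cat.Hom.toFunctor h.w
  have hglue : f ≫ (arrowFunctor α).toCatHom = g ≫ (arrowFunctor β).toCatHom :=
    Cat.ext (functor_arrow_ext hαβ (congrArg (· ⋙ P) hw) (congrArg (· ⋙ Q) hw))
  let R : D ⟶ Cat.of (Arrow E) := h.desc _ _ hglue
  have hleft : R ≫ Arrow.leftFunc.toCatHom = P.toCatHom :=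
    h.hom_ext (h.inl_desc_assoc _ _ hglue _) (h.inr_desc_assoc _ _ hglue _)
  have hright : R ≫ Arrow.rightFunc.toCatHom = Q.toCatHom :=
    h.hom_ext (h.inl_desc_assoc _ _ hglue _) (h.inr_desc_assoc _ _ hglue _)
  exact ⟨eqToHom (congrArg Cat.Hom.toFunctor hleft).symm ≫
    Functor.whiskerLeft R.toFunctor Arrow.leftToRight ≫
    eqToHom (congrArg Cat.Hom.toFunctor hright)⟩

lemma IsContractible.exists_natTrans_const {B D : Type*} [Category* B] [Category* D]
    (hB : IsContractible B) (K : B ⥤ D) {d : D} {b₀ : B} (e : d ⟶ K.obj b₀) :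
    ∃ τ : (Functor.const B).obj d ⟶ K, ∀ {b} (m : b₀ ⟶ b), τ.app b = e ≫ K.map m := by
  have hmap {b : B} (m m' : b₀ ⟶ b) : K.map m = K.map m' :=
    congrArg K.map ((hB.subsingleton_hom _ _).elim m m')
  refine ⟨{ app b := e ≫ K.map (hB.nonempty_hom b₀ b).some
            naturality b b' m := ?_ }, fun m => congrArg (e ≫ ·) (hmap _ m)⟩
  rw [Category.assoc, ← K.map_comp]
  exact (Category.id_comp _).trans (congrArg (e ≫ ·) (hmap _ _))

lemma isContractible_of_natTrans_const {D : Type*} [Category* D] [IsGroupoid D] {d : D}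
    (γ : (Functor.const D).obj d ⟶ 𝟭 D) : IsContractible D where
  nonempty := ⟨d⟩
  nonempty_hom x y := ⟨inv (γ.app x) ≫ γ.app y⟩
  subsingleton_hom x y := ⟨fun m m' => by
    rw [← cancel_epi (γ.app x)]
    exact (γ.naturality m).symm.trans (γ.naturality m')⟩

/-- The arrows from a base point to the objects of `B` and `C` glue to a contraction of `D`, because
every object of `A` is connected to the base point by an arrow of `A`. -/
lemma isContractible_of_isPushout {A B C D : Cat.{u, u}} {f : A ⟶ B} {g : A ⟶ C} {k : B ⟶ D}
    {l : C ⟶ D} (h : IsPushout f g k l) [IsGroupoid A] [IsConnected A] (hB : IsContractible B)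
    (hC : IsContractible C) : IsContractible D := by
  let _ : Groupoid A := Groupoid.ofIsGroupoid
  have : IsGroupoid D := isGroupoid_of_isPushout h inferInstance hB.isGroupoid hC.isGroupoid
  have hw : f.toFunctor ⋙ k.toFunctor = g.toFunctor ⋙ l.toFunctor :=
    congrArg Cat.Hom.toFunctor h.w
  obtain ⟨a⟩ : Nonempty A := inferInstance
  let d : D := k.toFunctor.obj (f.toFunctor.obj a)
  obtain ⟨α, hα⟩ := hB.exists_natTrans_const k.toFunctor (𝟙 d)
  obtain ⟨β, hβ⟩ := hC.exists_natTrans_const l.toFunctor (eqToHom (Functor.congr_obj hw a))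
  obtain ⟨γ⟩ := nonempty_natTrans_of_isPushout h (P := (Functor.const D).obj d) (Q := 𝟭 D) α β
    fun a' => by
      obtain ⟨m⟩ := nonempty_hom_of_preconnected_groupoid a a'
      have hαm : α.app _ = (f.toFunctor ⋙ k.toFunctor).map m :=
        (hα (f.toFunctor.map m)).trans (Category.id_comp _)
      have hβm : β.app _ = _ ≫ (g.toFunctor ⋙ l.toFunctor).map m := hβ (g.toFunctor.map m)
      calc Arrow.mk (α.app (f.toFunctor.obj a'))
        _ = (f.toFunctor ⋙ k.toFunctor).mapArrow.obj (Arrow.mk m) := congrArg Arrow.mk hαm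
        _ = (g.toFunctor ⋙ l.toFunctor).mapArrow.obj (Arrow.mk m) := by rw [hw]
        _ = Arrow.mk (eqToHom (Functor.congr_obj hw a) ≫ (g.toFunctor ⋙ l.toFunctor).map m) :=
          (Arrow.arrow_mk_eqToHom_comp _ _).symm
        _ = Arrow.mk (β.app (g.toFunctor.obj a')) := congrArg Arrow.mk hβm.symm
  exact isContractible_of_natTrans_const γ

lemma IsSphere.isContractible {n : ℕ} {S : Cat.{u, u}} (hS : IsSphere (n + 2) S) :
    IsContractible S := by
  obtain ⟨Y, A, B, C, p, f, g, k, l, hY, _, hB, hC, h⟩ := hS.exists_isPushout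
  have : IsGroupoid A := (isGroupoid_iff_of_isEquivalence p.toFunctor).2 hY.isGroupoid
  have := hY.isConnected
  have : IsConnected A := isConnected_of_equivalent p.toFunctor.asEquivalence.symm
  exact isContractible_of_isPushout h hB hC

lemma IsContractible.weaklyEquivalent_terminal {A : Cat.{u, u}} (hA : IsContractible A) :
    WeaklyEquivalent A (⊤_ Cat.{u, u}) :=
  .rel _ _ ⟨terminal.from A, (hA.isSurjectiveEquivalence_terminal _).acyclicFibration.2⟩

end VanKampen


section DisjointUnion

variable {I : Type*} {A B : I → Type u} [∀ i, Category.{v} (A i)] [∀ i, Category.{v} (B i)]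
  {F : ∀ i, A i ⥤ B i}

lemma injective_obj_sigma (hF : ∀ i, Function.Injective (F i).obj) :
    Function.Injective (Sigma.Functor.sigma F).obj :=
  Function.injective_id.sigma_map hF

lemma IsSurjectiveEquivalence.sigma (hF : ∀ i, IsSurjectiveEquivalence (F i)) :
    IsSurjectiveEquivalence (Sigma.Functor.sigma F) where
  full.map_surjective := by
    rintro ⟨i, x⟩ ⟨j, y⟩ (m : Sigma.SigmaHom ⟨i, (F i).obj x⟩ ⟨j, (F j).obj y⟩)
    obtain ⟨m⟩ := m
    obtain ⟨m, rfl⟩ := (hF i).full.map_surjective m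
    exact ⟨.mk m, rfl⟩
  faithful.map_injective := by
    rintro ⟨i, x⟩ ⟨_, y⟩ ⟨m⟩ ⟨m'⟩ h
    exact congrArg Sigma.SigmaHom.mk
      ((hF i).faithful.map_injective ((Sigma.incl i).map_injective h))
  surjective_obj := Function.surjective_id.sigma_map fun i => (hF i).surjective_obj

end DisjointUnion

section Coproduct

variable {I : Type u} {F G : I → Cat.{u, u}}

/-- The disjoint union of a family of categories, as a cofan. -/
def sigmaCofan (F : I → Cat.{u, u}) : Cofan F :=
  Cofan.mk (Cat.of (Σ i, F i)) fun i => (Sigma.incl (C := fun i => F i) i).toCatHom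

/-- The disjoint union of a family of categories is its coproduct. -/
def isColimitSigmaCofan (F : I → Cat.{u, u}) : IsColimit (sigmaCofan F) :=
  Cofan.IsColimit.mk _
    (fun s => (Sigma.desc (C := fun i => F i) fun i => (s.inj i).toFunctor).toCatHom)
    (fun _ _ => rfl)
    (fun s m hm => by
      have hm (i : I) := congrArg Cat.Hom.toFunctor (hm i)
      refine Cat.ext (Functor.hext ?_ ?_)
      · rintro ⟨i, x⟩
        exact Functor.congr_obj (hm i) x
      · rintro ⟨i, x⟩ ⟨_, y⟩ ⟨f⟩
        exact Functor.hcongr_hom (hm i) f)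

/-- The comparison of the chosen coproduct with the disjoint union. -/
noncomputable def sigmaIso (F : I → Cat.{u, u}) : ∐ F ≅ Cat.of (Σ i, F i) :=
  (coproductIsCoproduct F).coconePointUniqueUpToIso (isColimitSigmaCofan F)

lemma ι_sigmaIso_hom (F : I → Cat.{u, u}) (i : I) :
    Sigma.ι F i ≫ (sigmaIso F).hom = (Sigma.incl (C := fun i => F i) i).toCatHom :=
  (coproductIsCoproduct F).comp_coconePointUniqueUpToIso_hom (isColimitSigmaCofan F) ⟨i⟩

lemma sigmaMap_eq (φ : ∀ i, F i ⟶ G i) :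
    Limits.Sigma.map φ = (sigmaIso F).hom ≫
      (Sigma.Functor.sigma (C := fun i => F i) (D := fun i => G i)
        fun i => (φ i).toFunctor).toCatHom ≫ (sigmaIso G).inv := by
  rw [← Category.assoc, Iso.eq_comp_inv]
  refine Sigma.hom_ext _ _ fun i => ?_
  rw [Sigma.ι_map_assoc, ι_sigmaIso_hom, reassoc_of% ι_sigmaIso_hom]
  rfl

lemma bijective_obj_sigmaMap {φ : ∀ i, F i ⟶ G i}
    (hφ : ∀ i, Function.Bijective (φ i).toFunctor.obj) :
    Function.Bijective (Limits.Sigma.map φ).toFunctor.obj := by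
  rw [sigmaMap_eq]
  exact (bijective_obj_of_isIso (sigmaIso G).inv).comp
    ((Equiv.sigmaCongrRight fun i => Equiv.ofBijective _ (hφ i)).bijective.comp
      (bijective_obj_of_isIso (sigmaIso F).hom))

lemma injective_obj_sigmaMap {φ : ∀ i, F i ⟶ G i}
    (hφ : ∀ i, Function.Injective (φ i).toFunctor.obj) :
    Function.Injective (Limits.Sigma.map φ).toFunctor.obj := by
  rw [sigmaMap_eq]
  exact (bijective_obj_of_isIso (sigmaIso G).inv).injective.comp
    ((injective_obj_sigma hφ).comp (bijective_obj_of_isIso (sigmaIso F).hom).injective)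

lemma IsSurjectiveEquivalence.sigmaMap {φ : ∀ i, F i ⟶ G i}
    (hφ : ∀ i, IsSurjectiveEquivalence (φ i).toFunctor) :
    IsSurjectiveEquivalence (Limits.Sigma.map φ).toFunctor := by
  rw [sigmaMap_eq]
  exact (of_isIso (sigmaIso F).hom).comp
    ((IsSurjectiveEquivalence.sigma hφ).comp (of_isIso (sigmaIso G).inv))

end Coproduct

section CWComplex

lemma AttachesCells.isGroupoid {n : ℕ} {X Y : Cat.{u, u}} {j : Y ⟶ X} (hj : AttachesCells n j)
    (hY : IsGroupoid Y) : IsGroupoid X := by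
  obtain ⟨I, S, f, hS, -, B, i, p, l, -, ⟨-, hp⟩, -, h⟩ := hj
  have : p.toFunctor.IsEquivalence := (weakEquivalence_iff p).1 hp
  exact isGroupoid_of_isPushout h (isGroupoid_sigma fun i => (hS i).isGroupoid) hY
    ((isGroupoid_iff_of_isEquivalence p.toFunctor).2
      (isGroupoid_sigma fun _ => isContractible_terminal.isGroupoid))

lemma IsCWComplexOfDim.isGroupoid {n : ℕ} {X : Cat.{u, u}} (hX : IsCWComplexOfDim n X) :
    IsGroupoid X := by
  induction n generalizing X with
  | zero =>
    obtain ⟨-, I, ⟨e⟩⟩ := hX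
    exact isGroupoid_of_iso e (isGroupoid_sigma fun _ => isContractible_terminal.isGroupoid)
  | succ n ih =>
    obtain ⟨Y, j, hY, hj⟩ := hX
    exact hj.isGroupoid (ih hY)

lemma IsFiniteDimCWComplex.isGroupoid {X : Cat.{u, u}} (hX : IsFiniteDimCWComplex X) :
    IsGroupoid X :=
  hX.choose_spec.isGroupoid

lemma IsCWComplex.isGroupoid {X : Cat.{u, u}} (hX : IsCWComplex X) : IsGroupoid X := by
  obtain ⟨-, F, hF, -, hXF⟩ := hX
  exact hXF.isGroupoid_iff.2
    (isGroupoid_of_isColimit (colimit.isColimit F) fun n => (hF n).isGroupoid)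

end CWComplex

section Interval

lemma terminal_hom_ext {B : Cat.{u, u}} {F G : ⊤_ Cat.{u, u} ⟶ B}
    (h : F.toFunctor.obj default = G.toFunctor.obj default) : F = G := by
  have hobj (x) : F.toFunctor.obj x = G.toFunctor.obj x := Unique.eq_default x ▸ h
  refine Cat.ext (CategoryTheory.Functor.ext hobj fun x y m => ?_)
  obtain rfl : x = y := Subsingleton.elim _ _
  obtain rfl : m = 𝟙 x := Subsingleton.elim _ _
  simp

/-- The functor from the terminal category given by an object. -/
noncomputable def point {B : Cat.{u, u}} (b : B) : ⊤_ Cat.{u, u} ⟶ B :=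
  ((Functor.const _).obj b).toCatHom

lemma point_comp {B C : Cat.{u, u}} (b : B) (F : B ⟶ C) :
    point b ≫ F = point (F.toFunctor.obj b) :=
  terminal_hom_ext rfl

/-- The interval has two objects and exactly one morphism between any two of them. -/
abbrev Interval : Cat.{u, u} := Cat.of (ULiftHom.{u} WalkingIso.{u})

namespace Interval

/-- The first object of the interval. -/
def zero : Interval.{u} := ULiftHom.objUp.{u, u} WalkingIso.zero

/-- The second object of the interval. -/
def one : Interval.{u} := ULiftHom.objUp.{u, u} WalkingIso.one

lemma isContractible : IsContractible Interval.{u} :=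
  isContractible_codiscreteCat _

/-- Functors from the interval to `B` are isomorphisms of `B`. -/
def homEquiv {B : Cat.{u, u}} : (Interval ⟶ B) ≃ Σ x y : B, x ≅ y where
  toFun F := WalkingIso.equiv (ULiftHom.up ⋙ F.toFunctor)
  invFun e := (ULiftHom.down ⋙ WalkingIso.equiv.symm e).toCatHom
  left_inv F := congrArg (fun K => (ULiftHom.down ⋙ K).toCatHom)
    (WalkingIso.equiv.symm_apply_apply (ULiftHom.up ⋙ F.toFunctor))
  right_inv e := WalkingIso.equiv.apply_symm_apply e

/-- The functor from the interval given by an isomorphism. -/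
def lift {B : Cat.{u, u}} {x y : B} (e : x ≅ y) : Interval ⟶ B :=
  homEquiv.symm ⟨x, y, e⟩

lemma lift_injective {B : Cat.{u, u}} {x y : B} :
    Function.Injective (lift : (x ≅ y) → (Interval ⟶ B)) := fun e e' h => by
  simpa using homEquiv.symm.injective h

lemma lift_comp {B C : Cat.{u, u}} {x y : B} (e : x ≅ y) (F : B ⟶ C) :
    lift e ≫ F = lift (F.toFunctor.mapIso e) :=
  homEquiv.injective rfl

/-- The inclusion of the two objects of the interval. -/
noncomputable def endpoints : (⊤_ Cat.{u, u}) ⨿ (⊤_ Cat.{u, u}) ⟶ Interval.{u} :=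
  coprod.desc (point zero) (point one)

lemma endpoints_comp_lift {B : Cat.{u, u}} {x y : B} (e : x ≅ y) :
    endpoints ≫ lift e = coprod.desc (point x) (point y) := by
  rw [endpoints, coprod.desc_comp, point_comp, point_comp]
  rfl

lemma bijective_obj_endpoints : Function.Bijective endpoints.{u}.toFunctor.obj := by
  let x₀ := (coprod.inl (X := ⊤_ Cat.{u, u}) (Y := ⊤_ Cat.{u, u})).toFunctor.obj default
  let x₁ := (coprod.inr (X := ⊤_ Cat.{u, u}) (Y := ⊤_ Cat.{u, u})).toFunctor.obj default
  have h₀ : endpoints.toFunctor.obj x₀ = zero :=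
    Functor.congr_obj (congrArg Cat.Hom.toFunctor (coprod.inl_desc (point zero) (point one))) _
  have h₁ : endpoints.toFunctor.obj x₁ = one :=
    Functor.congr_obj (congrArg Cat.Hom.toFunctor (coprod.inr_desc (point zero) (point one))) _
  have hx (x) : x = x₀ ∨ x = x₁ :=
    (exists_obj_eq_or_of_isPushout (IsPushout.of_hasBinaryCoproduct' _ _) x).imp
      (fun ⟨y, hy⟩ => by rw [← hy, Unique.eq_default y])
      (fun ⟨y, hy⟩ => by rw [← hy, Unique.eq_default y])
  have h₀₁ : zero ≠ one := fun h => by cases h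
  constructor
  · intro x y hxy
    rcases hx x with rfl | rfl <;> rcases hx y with rfl | rfl
    exacts [rfl, (h₀₁ (h₀.symm.trans (hxy.trans h₁))).elim,
      (h₀₁ (h₀.symm.trans (hxy.symm.trans h₁))).elim, rfl]
  · rintro ⟨_ | _⟩
    exacts [⟨x₀, h₀⟩, ⟨x₁, h₁⟩]

end Interval

/-- The circle consists of two intervals with the same endpoints. -/
noncomputable abbrev Circle : Cat.{u, u} := pushout Interval.endpoints.{u} Interval.endpoints.{u}

namespace Circle

lemma isSphere : IsSphere 1 Circle.{u} :=
  IsSphere.succ_of_isPushout ⟨Iso.refl _⟩ Interval.isContractible Interval.isContractible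
    Interval.bijective_obj_endpoints.injective Interval.bijective_obj_endpoints.injective
    (IsPushout.of_hasPushout _ _)

/-- The functor from the circle given by a pair of parallel isomorphisms. -/
noncomputable def lift {B : Cat.{u, u}} {x y : B} (e e' : x ≅ y) : Circle ⟶ B :=
  pushout.desc (Interval.lift e) (Interval.lift e')
    ((Interval.endpoints_comp_lift e).trans (Interval.endpoints_comp_lift e').symm)

/-- The functor which identifies the two intervals of the circle. -/
noncomputable def fold : Circle.{u} ⟶ Interval.{u} := pushout.desc (𝟙 _) (𝟙 _) rfl

lemma bijective_obj_fold : Function.Bijective fold.{u}.toFunctor.obj := by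
  refine bijective_obj_of_comp (F := pushout.inl _ _)
    (bijective_obj_of_isPushout (IsPushout.of_hasPushout _ _) Interval.bijective_obj_endpoints) ?_
  rw [fold, pushout.inl_desc]
  exact bijective_obj_of_isIso _

lemma lift_comp_eq_fold_comp_iff {B C : Cat.{u, u}} {x y : B} {e e' : x ≅ y} {F : B ⟶ C}
    {k : Interval ⟶ C} :
    lift e e' ≫ F = fold ≫ k ↔ Interval.lift e ≫ F = k ∧ Interval.lift e' ≫ F = k := by
  refine ⟨fun h => ⟨?_, ?_⟩, fun ⟨h, h'⟩ => pushout.hom_ext ?_ ?_⟩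
  · simpa only [lift, fold, pushout.inl_desc_assoc, Category.id_comp] using
      congrArg (pushout.inl _ _ ≫ ·) h
  · simpa only [lift, fold, pushout.inr_desc_assoc, Category.id_comp] using
      congrArg (pushout.inr _ _ ≫ ·) h
  · simpa only [lift, fold, pushout.inl_desc_assoc, Category.id_comp] using h
  · simpa only [lift, fold, pushout.inr_desc_assoc, Category.id_comp] using h'

end Circle

end Interval

section AttachesCells

/-- Each contractible category `B i` plays the role of the disc bounded by the sphere `S i`. -/
lemma attachesCells_of_isPushout {n : ℕ} {I : Type u} {S B : I → Cat.{u, u}}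
    {i : ∀ a, S a ⟶ B a} (hS : ∀ a, IsSphere n (S a)) (hB : ∀ a, IsContractible (B a))
    (hi : ∀ a, Function.Injective (i a).toFunctor.obj) {X Y : Cat.{u, u}} {f : ∐ S ⟶ Y}
    {j : Y ⟶ X} {l : ∐ B ⟶ X} (h : IsPushout f (Limits.Sigma.map i) j l) : AttachesCells n j :=
  ⟨I, S, f, hS, isCofibrant _, ∐ B, Limits.Sigma.map i,
    Limits.Sigma.map fun a => terminal.from (B a), l,
    (cofibration_iff _).2 (injective_obj_sigmaMap hi),
    (IsSurjectiveEquivalence.sigmaMap fun a =>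
      (hB a).isSurjectiveEquivalence_terminal _).acyclicFibration,
    (Sigma.map_comp_map _ _).trans (congrArg Limits.Sigma.map (Subsingleton.elim _ _)), h⟩

lemma attachesCells_id (n : ℕ) (X : Cat.{u, u}) : AttachesCells n (𝟙 X) :=
  attachesCells_of_isPushout (I := PEmpty) (S := PEmpty.elim) (B := PEmpty.elim)
    (i := fun a => a.elim) (fun a => a.elim) (fun a => a.elim) (fun a => a.elim)
    (f := Sigma.desc fun a => a.elim) (l := Sigma.desc fun a => a.elim)
    (have (a : PEmpty.{u + 1}) : IsIso (a.elim : (a.elim : Cat.{u, u}) ⟶ a.elim) := a.elim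
    IsPushout.of_vert_isIso ⟨Sigma.hom_ext _ _ fun a => a.elim⟩)

end AttachesCells

section Quotients

variable {A B C : Cat.{v, u}} {p : A ⟶ B}

lemma isIso_of_bijective_obj [p.toFunctor.Full] [p.toFunctor.Faithful]
    (hp : Function.Bijective p.toFunctor.obj) : IsIso p := by
  let e := Equiv.ofBijective _ hp
  have he (b : B) : p.toFunctor.obj (e.symm b) = b := e.apply_symm_apply b
  let q : B ⥤ A :=
    { obj := e.symm
      map {b b'} g := p.toFunctor.preimage (eqToHom (he b) ≫ g ≫ eqToHom (he b').symm)
      map_id b := p.toFunctor.map_injective (by simp)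
      map_comp g g' := p.toFunctor.map_injective (by simp) }
  have hqp : q ⋙ p.toFunctor = 𝟭 B :=
    CategoryTheory.Functor.ext he fun _ _ _ => p.toFunctor.map_preimage _
  have he' (a : A) : (p.toFunctor ⋙ q).obj a = a := e.symm_apply_apply a
  have hpq : p.toFunctor ⋙ q = 𝟭 A :=
    CategoryTheory.Functor.ext he' fun _ _ _ =>
      p.toFunctor.map_injective (by simp [q, eqToHom_map])
  exact ⟨q.toCatHom, Cat.ext hpq, Cat.ext hqp⟩

lemma epi_of_full_of_surjective_obj [p.toFunctor.Full]
    (hp : Function.Surjective p.toFunctor.obj) : Epi p where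
  left_cancellation d d' h := by
    have h' := congrArg Cat.Hom.toFunctor h
    refine Cat.ext (Functor.hext (fun b => ?_) fun b b' g => ?_)
    · obtain ⟨a, rfl⟩ := hp b
      exact Functor.congr_obj h' a
    · obtain ⟨a, rfl⟩ := hp b
      obtain ⟨a', rfl⟩ := hp b'
      obtain ⟨f, rfl⟩ := p.toFunctor.map_surjective g
      exact Functor.hcongr_hom h' f

/-- Such a functor exhibits its target as the quotient of its source by a congruence. -/
lemma exists_comp_eq_of_full_of_bijective_obj [p.toFunctor.Full]
    (hp : Function.Bijective p.toFunctor.obj) (h : A ⟶ C)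
    (hh : ∀ {x y : A} (f g : x ⟶ y), p.toFunctor.map f = p.toFunctor.map g →
      h.toFunctor.map f = h.toFunctor.map g) : ∃ d : B ⟶ C, p ≫ d = h := by
  let r := p.toFunctor.homRel
  let Q := Cat.of (CategoryTheory.Quotient r)
  let π : A ⟶ Q := (Quotient.functor r).toCatHom
  let k : Q ⟶ B := (CategoryTheory.Quotient.lift r p.toFunctor fun _ _ _ _ => id).toCatHom
  let d : Q ⟶ C := (CategoryTheory.Quotient.lift r h.toFunctor fun _ _ => hh).toCatHom
  have : k.toFunctor.Full := inferInstanceAs (CategoryTheory.Quotient.lift r p.toFunctor _).Full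
  have : k.toFunctor.Faithful :=
    inferInstanceAs (CategoryTheory.Quotient.lift r p.toFunctor _).Faithful
  have : IsIso k := isIso_of_bijective_obj
    (bijective_obj_of_comp (F := π) (Quotient.equiv r).symm.bijective hp)
  refine ⟨inv k ≫ d, ?_⟩
  change (π ≫ k) ≫ inv k ≫ d = h
  rw [Category.assoc, IsIso.hom_inv_id_assoc]
  rfl

end Quotients

section TwoCells

variable {A B C : Cat.{u, u}} {p : A ⟶ B}

/-- A relator of `p` is a pair of parallel isomorphisms which `p` identifies. -/
structure Relator (p : A ⟶ B) : Type u where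
  /-- The source of the two isomorphisms. -/
  src : A
  /-- The target of the two isomorphisms. -/
  tgt : A
  /-- The first isomorphism. -/
  fst : src ≅ tgt
  /-- The second isomorphism. -/
  snd : src ≅ tgt
  mapIso_eq : p.toFunctor.mapIso fst = p.toFunctor.mapIso snd

lemma exists_comp_eq_of_relators [IsGroupoid A] [p.toFunctor.Full]
    (hp : Function.Bijective p.toFunctor.obj) {h : A ⟶ C}
    (hh : ∀ r : Relator p, Interval.lift r.fst ≫ h = Interval.lift r.snd ≫ h) :
    ∃ d : B ⟶ C, p ≫ d = h := by
  refine exists_comp_eq_of_full_of_bijective_obj hp h fun f g hfg => ?_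
  have key := hh ⟨_, _, asIso f, asIso g, Iso.ext hfg⟩
  rw [Interval.lift_comp, Interval.lift_comp] at key
  exact congrArg Iso.hom (Interval.lift_injective key)

lemma isPushout_relators [IsGroupoid A] [p.toFunctor.Full]
    (hp : Function.Bijective p.toFunctor.obj) :
    IsPushout (Sigma.desc fun r : Relator p => Circle.lift r.fst r.snd)
      (Limits.Sigma.map fun _ : Relator p => Circle.fold) p
      (Sigma.desc fun r : Relator p => Interval.lift r.fst ≫ p) := by
  refine ⟨⟨Sigma.hom_ext _ _ fun r => ?_⟩, ⟨PushoutCocone.isColimitAux' _ fun s => ?_⟩⟩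
  · rw [Sigma.ι_desc_assoc, Sigma.ι_map_assoc, Sigma.ι_desc, Circle.lift_comp_eq_fold_comp_iff,
      Interval.lift_comp, Interval.lift_comp, r.mapIso_eq]
    exact ⟨rfl, rfl⟩
  · have hs (r : Relator p) := Circle.lift_comp_eq_fold_comp_iff.1 <|
      show Circle.lift r.fst r.snd ≫ s.inl =
          Circle.fold ≫ Sigma.ι (fun _ : Relator p => Interval.{u}) r ≫ s.inr by
        simpa only [Sigma.ι_desc_assoc, Sigma.ι_map_assoc] using
          congrArg (Sigma.ι (fun _ : Relator p => Circle.{u}) r ≫ ·) s.condition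
    have hd := exists_comp_eq_of_relators hp fun r => (hs r).1.trans (hs r).2.symm
    have := epi_of_full_of_surjective_obj hp.surjective
    refine ⟨hd.choose, hd.choose_spec, Sigma.hom_ext _ _ fun r => ?_, fun {m} hm _ =>
      (cancel_epi p).1 (hm.trans hd.choose_spec.symm)⟩
    exact (Sigma.ι_desc_assoc _ _ _).trans <| (Category.assoc _ _ _).trans <|
      (congrArg (Interval.lift r.fst ≫ ·) hd.choose_spec).trans (hs r).1

lemma attachesCells_one_of_full_of_bijective_obj [IsGroupoid A] [p.toFunctor.Full]
    (hp : Function.Bijective p.toFunctor.obj) : AttachesCells 1 p :=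
  attachesCells_of_isPushout (fun _ => Circle.isSphere) (fun _ => Interval.isContractible)
    (fun _ => Circle.bijective_obj_fold.injective) (isPushout_relators hp)

end TwoCells

section OneSkeleton

lemma full_of_forall_interval_lift {A B : Cat.{u, u}} [IsGroupoid B] {p : A ⟶ B}
    (hp : Function.Injective p.toFunctor.obj)
    (h : ∀ {x y : B} (e : x ≅ y), ∃ k : Interval ⟶ A, k ≫ p = Interval.lift e) :
    p.toFunctor.Full where
  map_surjective g := by
    obtain ⟨k, hk⟩ := h (asIso g)
    obtain ⟨⟨x, y, e⟩, rfl⟩ := Interval.homEquiv.symm.surjective k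
    have key := Interval.homEquiv.symm.injective ((Interval.lift_comp e p).symm.trans hk)
    obtain ⟨hx, key⟩ := Sigma.mk.inj_iff.1 key
    obtain rfl := hp hx
    obtain ⟨hy, key⟩ := Sigma.mk.inj_iff.1 (eq_of_heq key)
    obtain rfl := hp hy
    exact ⟨e.hom, congrArg Iso.hom (eq_of_heq key)⟩

variable (X : Cat.{u, u})

/-- The `0`-skeleton of `X` has one `0`-cell for each object of `X`. -/
noncomputable abbrev ZeroSkeleton : Cat.{u, u} := ∐ fun _ : X => ⊤_ Cat.{u, u}

/-- The functor from the `0`-skeleton which sends each `0`-cell to the corresponding object. -/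
noncomputable def ZeroSkeleton.eval : ZeroSkeleton X ⟶ X := Sigma.desc point

lemma ZeroSkeleton.bijective_obj_eval :
    Function.Bijective (ZeroSkeleton.eval X).toFunctor.obj := by
  let F := (sigmaIso fun _ : X => ⊤_ Cat.{u, u}).inv ≫ eval X
  have hF (x : X) (t : ⊤_ Cat.{u, u}) : F.toFunctor.obj ⟨x, t⟩ = x := by
    have h : Sigma.ι (fun _ : X => ⊤_ Cat.{u, u}) x ≫ (sigmaIso _).hom ≫ F = point x := by
      rw [Iso.hom_inv_id_assoc, eval, Sigma.ι_desc]
    have hι := (reassoc_of% ι_sigmaIso_hom (fun _ : X => ⊤_ Cat.{u, u}) x) F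
    exact Functor.congr_obj (congrArg Cat.Hom.toFunctor (hι.symm.trans h)) t
  refine bijective_obj_of_comp (F := (sigmaIso _).inv) (bijective_obj_of_isIso _)
    ⟨?_, fun x => ⟨⟨x, default⟩, hF x _⟩⟩
  rintro ⟨x, s⟩ ⟨y, t⟩ h
  obtain rfl : x = y := (hF x s).symm.trans (h.trans (hF y t))
  rw [Subsingleton.elim s t]

/-- The edges of `X` are its isomorphisms. -/
abbrev Edge : Type u := Σ x y : X, x ≅ y

/-- The attaching map of the edges of `X` to its `0`-skeleton. -/
noncomputable def edgeBoundary :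
    (∐ fun _ : Edge X => (⊤_ Cat.{u, u}) ⨿ (⊤_ Cat.{u, u})) ⟶ ZeroSkeleton X :=
  Sigma.desc fun e => coprod.desc (Sigma.ι (fun _ : X => ⊤_ Cat.{u, u}) e.1)
    (Sigma.ι (fun _ : X => ⊤_ Cat.{u, u}) e.2.1)

/-- The inclusion of the endpoints of a family of intervals indexed by the edges of `X`. -/
noncomputable def edgeEndpoints :
    (∐ fun _ : Edge X => (⊤_ Cat.{u, u}) ⨿ (⊤_ Cat.{u, u})) ⟶ ∐ fun _ : Edge X => Interval.{u} :=
  Limits.Sigma.map fun _ => Interval.endpoints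

/-- The `1`-skeleton of `X` has one `0`-cell for each object and one `1`-cell for each isomorphism
of `X`. It is the free groupoid on the isomorphisms of `X`. -/
noncomputable abbrev OneSkeleton : Cat.{u, u} := pushout (edgeBoundary X) (edgeEndpoints X)

namespace OneSkeleton

/-- The inclusion of the `0`-skeleton. -/
noncomputable abbrev inclusion : ZeroSkeleton X ⟶ OneSkeleton X := pushout.inl _ _

lemma attachesCells_inclusion : AttachesCells 0 (inclusion X) :=
  attachesCells_of_isPushout (n := 0) (fun _ => ⟨Iso.refl _⟩) (fun _ => Interval.isContractible)
    (fun _ => Interval.bijective_obj_endpoints.injective) (IsPushout.of_hasPushout _ _)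

lemma isCWComplexOfDim : IsCWComplexOfDim 1 (OneSkeleton X) :=
  ⟨ZeroSkeleton X, inclusion X, ⟨isCofibrant _, X, ⟨Iso.refl _⟩⟩, attachesCells_inclusion X⟩

/-- The functor from the `1`-skeleton which composes each formal composite of isomorphisms. -/
noncomputable def eval : OneSkeleton X ⟶ X :=
  pushout.desc (ZeroSkeleton.eval X) (Sigma.desc fun e => Interval.lift e.2.2) <| by
    refine Sigma.hom_ext _ _ fun e => ?_
    rw [edgeBoundary, edgeEndpoints, Sigma.ι_desc_assoc, Sigma.ι_map_assoc, Sigma.ι_desc,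
      Interval.endpoints_comp_lift, coprod.desc_comp, ZeroSkeleton.eval, Sigma.ι_desc, Sigma.ι_desc]

lemma bijective_obj_eval : Function.Bijective (eval X).toFunctor.obj := by
  refine bijective_obj_of_comp (F := inclusion X) (bijective_obj_of_isPushout
    (IsPushout.of_hasPushout _ _) (bijective_obj_sigmaMap fun _ =>
      Interval.bijective_obj_endpoints)) ?_
  rw [eval, pushout.inl_desc]
  exact ZeroSkeleton.bijective_obj_eval X

instance full_eval [IsGroupoid X] : (eval X).toFunctor.Full :=
  full_of_forall_interval_lift (bijective_obj_eval X).injective fun e =>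
    ⟨Sigma.ι (fun _ : Edge X => Interval.{u}) ⟨_, _, e⟩ ≫ pushout.inr _ _, by
      rw [eval, Category.assoc, pushout.inr_desc, Sigma.ι_desc]⟩

lemma attachesCells_eval [IsGroupoid X] : AttachesCells 1 (eval X) :=
  have : IsGroupoid (OneSkeleton X) := (isCWComplexOfDim X).isGroupoid
  attachesCells_one_of_full_of_bijective_obj (bijective_obj_eval X)

end OneSkeleton

end OneSkeleton

section Conclusion

variable (X : Cat.{u, u})

lemma isCWComplexOfDim_of_isGroupoid [IsGroupoid X] (n : ℕ) : IsCWComplexOfDim (n + 2) X := by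
  induction n with
  | zero => exact ⟨_, _, OneSkeleton.isCWComplexOfDim X, OneSkeleton.attachesCells_eval X⟩
  | succ n ih => exact ⟨_, _, ih, attachesCells_id _ _⟩

/-- The skeletal filtration of a groupoid, which is constant from dimension `2` on. -/
noncomputable def skeleton : ℕ → Cat.{u, u}
  | 0 => ZeroSkeleton X
  | 1 => OneSkeleton X
  | _ + 2 => X

/-- The transition maps of the skeletal filtration. -/
noncomputable def skeletonMap : ∀ n, skeleton X n ⟶ skeleton X (n + 1)
  | 0 => OneSkeleton.inclusion X
  | 1 => OneSkeleton.eval X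
  | _ + 2 => 𝟙 X

lemma isCWComplexOfDim_skeleton [IsGroupoid X] : ∀ n, IsCWComplexOfDim n (skeleton X n)
  | 0 => ⟨isCofibrant _, X, ⟨Iso.refl _⟩⟩
  | 1 => OneSkeleton.isCWComplexOfDim X
  | n + 2 => isCWComplexOfDim_of_isGroupoid X n

lemma attachesCells_skeletonMap [IsGroupoid X] : ∀ n, AttachesCells n (skeletonMap X n)
  | 0 => OneSkeleton.attachesCells_inclusion X
  | 1 => OneSkeleton.attachesCells_eval X
  | n + 2 => attachesCells_id (n + 2) X

lemma isEventuallyConstantFrom_ofSequence {C : Type*} [Category* C] {F : ℕ → C}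
    (f : ∀ n, F n ⟶ F (n + 1)) {N : ℕ} (hf : ∀ n, N ≤ n → IsIso (f n)) :
    (Functor.ofSequence f).IsEventuallyConstantFrom N := by
  have h (m : ℕ) (hm : N ≤ m) : IsIso ((Functor.ofSequence f).map (homOfLE hm)) := by
    induction hm with
    | refl => exact inferInstanceAs (IsIso ((Functor.ofSequence f).map (𝟙 N)))
    | @step m hm ih =>
      have : IsIso ((Functor.ofSequence f).map (homOfLE (Nat.le_succ m))) := by
        rw [Functor.ofSequence_map_homOfLE_succ]
        exact hf m hm
      rw [← homOfLE_comp hm (Nat.le_succ m), Functor.map_comp]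
      infer_instance
  exact fun m g => h m (leOfHom g)

lemma isCWComplex_of_isGroupoid [IsGroupoid X] : IsCWComplex X := by
  refine ⟨isCofibrant X, Functor.ofSequence (skeletonMap X), isCWComplexOfDim_skeleton X,
    fun n => ⟨isCWComplexOfDim_skeleton X n, ?_⟩, ?_⟩
  · rw [Functor.ofSequence_map_homOfLE_succ]
    exact attachesCells_skeletonMap X n
  · have hX : (Functor.ofSequence (skeletonMap X)).IsEventuallyConstantFrom 2 :=
      isEventuallyConstantFrom_ofSequence _ fun n hn => by
        obtain ⟨n, rfl⟩ := Nat.exists_eq_add_of_le' hn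
        exact inferInstanceAs (IsIso (𝟙 X))
    let ι : X ⟶ _ := colimit.ι (Functor.ofSequence (skeletonMap X)) 2
    have : IsIso ι := hX.isIso_ι_of_isColimit (colimit.isColimit _)
    exact .rel _ _ ⟨ι, weakEquivalence_of_isIso ι⟩

end Conclusion

end FormalCW

theorem mainTheorem3 :
    -- a small category is weakly equivalent to a CW-complex iff it is a groupoid
    (∀ X : Cat.{u, u},
      (∃ K : Cat.{u, u}, FormalCW.IsCWComplex K ∧ FormalCW.WeaklyEquivalent X K) ↔
        IsGroupoid X) ∧
    -- the same with finite-dimensional CW-complexes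
    (∀ X : Cat.{u, u},
      (∃ K : Cat.{u, u}, FormalCW.IsFiniteDimCWComplex K ∧ FormalCW.WeaklyEquivalent X K) ↔
        IsGroupoid X) ∧
    -- every CW-complex is weakly equivalent to a 2-dimensional one
    (∀ K : Cat.{u, u}, FormalCW.IsCWComplex K ∨ FormalCW.IsFiniteDimCWComplex K →
      ∃ L : Cat.{u, u}, FormalCW.IsCWComplexOfDim 2 L ∧ FormalCW.WeaklyEquivalent K L) ∧
    -- in each dimension at least 2, spheres exist, and all of them are contractible
    (∀ n : ℕ, 2 ≤ n →
      (∃ S : Cat.{u, u}, FormalCW.IsSphere n S) ∧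
      ∀ S : Cat.{u, u}, FormalCW.IsSphere n S →
        FormalCW.WeaklyEquivalent S (⊤_ Cat.{u, u})) := by
  refine ⟨fun X => ⟨?_, fun hX => ⟨X, FormalCW.isCWComplex_of_isGroupoid X, .refl X⟩⟩,
    fun X => ⟨?_, fun hX => ⟨X, ⟨2, FormalCW.isCWComplexOfDim_of_isGroupoid X 0⟩, .refl X⟩⟩,
    fun K hK => ?_, fun n hn => ⟨FormalCW.exists_isSphere n, fun S hS => ?_⟩⟩
  · rintro ⟨K, hK, hXK⟩
    exact hXK.isGroupoid_iff.2 hK.isGroupoid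
  · rintro ⟨K, hK, hXK⟩
    exact hXK.isGroupoid_iff.2 hK.isGroupoid
  · have : IsGroupoid K := hK.elim (·.isGroupoid) (·.isGroupoid)
    exact ⟨K, FormalCW.isCWComplexOfDim_of_isGroupoid K 0, .refl K⟩
  · obtain ⟨m, rfl⟩ := Nat.exists_eq_add_of_le' hn
    exact hS.isContractible.weaklyEquivalent_terminal
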